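/- Two real $n\times d$ matrices $A,A'$ are called neighbors if they differ on a single row $i$ only, and $\|A_{(i)}-A'_{(i)}\|_2^2\le 1$. Write $\sigma_1(A)\ge\dots\ge\sigma_d(A)\ge 0$ for the $d$ singular values of $A$ (the square roots of the eigenvalues of $A^{\mathsf T}A$). Say that a randomized algorithm $\mathsf{ALG}$ is $(\epsilon,\delta)$-differentially private on a set $D$ of matrices if for all neighbors $A,A'$ at least one of which lies in $D$, and every measurable set $S$ of outputs, $$\Pr[\mathsf{ALG}(A)\in S]\le e^{\epsilon}\Pr[\mathsf{ALG}(A')\in S]+\delta$$ and the same holds with $A$ and $A'$ exchanged. Let $\epsilon,\delta,\eta,\nu>0$ with $\epsilon\le 2\ln(2/\delta)$ (which holds, for instance, whenever $\epsilon\le1$ and $\delta\le 1$), and put $$r=\left\lceil\frac{8\ln(2/\nu)}{\eta^2}\right\rceil \ (\text{read as } 0 \text{ if } \nu\ge 2),\qquad w=\frac{16\sqrt{r\ln(2/\delta)}}{\epsilon}\,\ln\!\left(\frac{16r}{\delta}\right)\ (\text{read as } 0 \text{ if } r=0).$$ Let $M$ be an $r\times n$ matrix with i.i.d. $\mathcal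 N(0,1)$ entries, and let $\mathrm{Lap}(1/\epsilon)$ be Laplace noise with density $\frac{\epsilon}{2}e^{-\epsilon|t|}$, independent of $M$. Then for all $n,d$: 1. The algorithm $A\mapsto MA$ is $(\epsilon,\delta)$-differentially private on the set of $n\times d$ matrices $A$ all of whose singular values $\sigma_1(A),\dots,\sigma_d(A)$ are at least $w$. 2. The algorithm $A\mapsto \sigma_d(A)+\mathrm{Lap}(1/\epsilon)$ is $(\epsilon,0)$-differentially private on all $n\times d$ matrices, and the algorithm that releases $\sigma_d(A)+\mathrm{Lap}(1/\epsilon)$ and then $MA$ is $(2\epsilon,\delta)$-differentially private on the set of $n\times d$ matrices $A$ with $\sigma_d(A)>10w$. 3. If $\eta<1/2$, then for every $n\times d$ matrix $A$ and every unit vector $x\in\mathbb R^d$, the output $O=MA$ satisfies, with probability at least $1-\nu$, $$(1-\eta)\|Ax\|^2\le\tfrac1r\|Ox\|^2\le(1+\eta)\|Ax\|^2 .$$ -/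

import Mathlib

open MeasureTheory ProbabilityTheory

noncomputable section

/-- Two `n × d` matrices are neighbors if they differ only on a single row `i`, and the squared
Euclidean norm of the difference of the two `i`-th rows is at most `1`. -/
def NeighboringMatrices {n d : ℕ} (A A' : Matrix (Fin n) (Fin d) ℝ) : Prop :=
  ∃ i : Fin n, (∀ j : Fin n, j ≠ i → ∀ k : Fin d, A j k = A' j k) ∧
    ∑ k : Fin d, (A i k - A' i k) ^ 2 ≤ 1

/-- `(ε, δ)`-differential privacy on the inputs in `D`, for a randomized algorithm given by the law
of its output on every input: the privacy inequality holds, in both directions, for every pair of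
neighboring inputs at least one of which lies in `D`.
For `D = Set.univ` this is the usual `(ε, δ)`-differential privacy; for general `D` it contains
the usual condition for the algorithm restricted to inputs from `D`. -/
def DifferentiallyPrivateOn {I R : Type*} [MeasurableSpace R] (nbr : I → I → Prop) (D : Set I)
    (alg : I → Measure R) (ε δ : ℝ) : Prop :=
  ∀ x y : I, nbr x y → (x ∈ D ∨ y ∈ D) → ∀ S : Set R, MeasurableSet S →
    alg x S ≤ ENNReal.ofReal (Real.exp ε) * alg y S + ENNReal.ofReal δ ∧
    alg y S ≤ ENNReal.ofReal (Real.exp ε) * alg x S + ENNReal.ofReal δ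

/-- The singular values of an `n × d` matrix `A`, in decreasing order and with multiplicity,
indexed from `0`: for `i < d` these are the square roots of the eigenvalues of `Aᵀ A`, so that
`σ₁, …, σ_d` are `sv A 0, …, sv A (d - 1)`. -/
def sv {n d : ℕ} (A : Matrix (Fin n) (Fin d) ℝ) (i : ℕ) : ℝ :=
  (Matrix.toEuclideanLin A).singularValues i

/-- The least singular value `σ_d` of an `n × d` matrix (`0` if `d = 0`). -/
def leastSV {n d : ℕ} (A : Matrix (Fin n) (Fin d) ℝ) : ℝ :=
  sv A (d - 1)

/-- The number of rows of the random projection: `8 ln (2 / ν) / η ^ 2`, rounded up. -/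
def numRows (η ν : ℝ) : ℕ :=
  ⌈8 * Real.log (2 / ν) / η ^ 2⌉₊

/-- The spectral threshold `w = 16 √(r ln (2 / δ)) / ε * ln (16 r / δ)`. -/
def threshold (ε δ : ℝ) (r : ℕ) : ℝ :=
  16 * √(r * Real.log (2 / δ)) / ε * Real.log (16 * r / δ)

/-- The law of an `r × n` matrix with i.i.d. standard normal entries. -/
def gaussianMatrix (r n : ℕ) : Measure (Fin r → Fin n → ℝ) :=
  Measure.pi fun _ => Measure.pi fun _ => gaussianReal 0 1

/-- The centered Laplace distribution `Lap(b)`, with density `exp (-|t| / b) / (2 b)`. -/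
def laplace (b : ℝ) : Measure ℝ :=
  volume.withDensity fun t => ENNReal.ofReal (Real.exp (-|t| / b) / (2 * b))

/-- The algorithm that draws an `r × n` matrix `M` with i.i.d. standard normal entries and outputs
`M A`. -/
def gaussianRelease (r : ℕ) {n d : ℕ} (A : Matrix (Fin n) (Fin d) ℝ) :
    Measure (Fin r → Fin d → ℝ) :=
  (gaussianMatrix r n).map fun M => Matrix.of M * A

/-- The algorithm that outputs `σ_d + Lap(1 / ε)`. -/
def leastSVRelease (ε : ℝ) {n d : ℕ} (A : Matrix (Fin n) (Fin d) ℝ) : Measure ℝ :=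
  (laplace (1 / ε)).map fun t => leastSV A + t

/-- The algorithm that outputs `σ_d + Lap(1 / ε)` and then `M A`, where `M` is an `r × n` matrix
with i.i.d. standard normal entries, independent of the Laplace noise. -/
def leastSVThenGaussianRelease (ε : ℝ) (r : ℕ) {n d : ℕ} (A : Matrix (Fin n) (Fin d) ℝ) :
    Measure (ℝ × (Fin r → Fin d → ℝ)) :=
  (leastSVRelease ε A).prod (gaussianRelease r A)

/-- The squared Euclidean norm. -/
def sqNorm {m : ℕ} (v : Fin m → ℝ) : ℝ :=
  ∑ i, v i ^ 2

end

/-! Privacy of `M A`. If all singular values of `A` are at least `w > 0`, then `A` has full column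
rank, so the changed row has the form `v = Aᵀ t` with `‖t‖ ≤ 1 / w`, and the neighbor is `A' = (1 +
eᵢ tᵀ) A` (`NeighboringMatrices.exists_eq_add`). Hence `M A` and `M A'` are the images under one map
of `M` and of `M (1 + eᵢ tᵀ)`. It remains to compare these two laws, and nothing is asked of `A'`.

The rows are independent, and on a row the perturbation is the linear map `m ↦ m + mᵢ t` of
determinant `1 + tᵢ`, so the privacy loss is explicit (`gaussianVector_map_add_smul`). Its
exponential moments are exact Gaussian integrals (`lintegral_exp_rowLoss`). Their first-order terms
in `t` cancel, which leaves a bound of order `s² ‖t‖²` per row for moments of order up to `2 s`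
(`lossExponent_bounds`). Markov's inequality with `s = 2 ln(2/δ) / ε` then bounds the probability
mass not covered by the factor `e^ε` by `δ`; the size of `w` makes this work.

The least singular value is 1-Lipschitz along neighbors, so Laplace noise makes it private, and
independent composition adds the two budgets. The utility bound is a chi-square Chernoff bound for
`‖M y‖²` with `y = A x`. -/

/-! ### Finite products of measures and densities. -/

theorem lintegral_fin_prod_eq_prod {n : ℕ} {E : Type*} [MeasurableSpace E]
    (μ : Fin n → Measure E) [∀ i, SigmaFinite (μ i)] (f : Fin n → E → ENNReal)
    (hf : ∀ i, Measurable (f i)) :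
    ∫⁻ x, ∏ i, f i (x i) ∂(Measure.pi μ) = ∏ i, ∫⁻ x, f i x ∂(μ i) := by
  induction n with
  | zero => simp
  | succ n ih =>
    rw [← ((measurePreserving_piFinSuccAbove μ 0).symm).lintegral_comp (by fun_prop)]
    simp only [Fin.prod_univ_succ]
    have h : ∀ a : E × (Fin n → E),
        f 0 ((MeasurableEquiv.piFinSuccAbove (fun _ => E) 0).symm a 0) *
          ∏ i : Fin n, f i.succ ((MeasurableEquiv.piFinSuccAbove (fun _ => E) 0).symm a i.succ) =
        f 0 a.1 * ∏ i : Fin n, f i.succ (a.2 i) := by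
      intro a
      simp [MeasurableEquiv.piFinSuccAbove, Fin.insertNthEquiv]
    simp only [h]
    rw [lintegral_prod_mul (f := f 0) (g := fun y : Fin n → E => ∏ i, f i.succ (y i))
      (hf 0).aemeasurable
      (Finset.measurable_prod _ fun i _ => (hf i.succ).comp (measurable_pi_apply i)).aemeasurable]
    simp only [Fin.succAbove_zero]
    rw [ih (fun i => μ i.succ) (fun i => f i.succ) (fun i => hf i.succ)]

theorem pi_withDensity {n : ℕ} {E : Type*} [MeasurableSpace E]
    (μ : Measure E) [SigmaFinite μ] (f : E → ENNReal) (hf : Measurable f)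
    [SigmaFinite (μ.withDensity f)] :
    Measure.pi (fun _ : Fin n => μ.withDensity f) =
      (Measure.pi fun _ : Fin n => μ).withDensity fun x => ∏ i, f (x i) := by
  refine Measure.pi_eq fun s hs => ?_
  rw [withDensity_apply _ (MeasurableSet.univ_pi hs), ← lintegral_indicator (.univ_pi hs)]
  have h : ∀ x : Fin n → E, (Set.univ.pi s).indicator (fun x => ∏ i, f (x i)) x =
      ∏ i, (s i).indicator f (x i) := by
    intro x
    by_cases hx : x ∈ Set.univ.pi s
    · rw [Set.indicator_of_mem hx]
      exact Finset.prod_congr rfl fun i _ => (Set.indicator_of_mem (hx i trivial) f).symm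
    · rw [Set.indicator_of_notMem hx]
      simp only [Set.mem_pi, not_forall] at hx
      obtain ⟨i, _, hi⟩ := hx
      exact (Finset.prod_eq_zero (Finset.mem_univ i) (Set.indicator_of_notMem hi f)).symm
  simp only [h]
  rw [lintegral_fin_prod_eq_prod _ _ fun i => hf.indicator (hs i)]
  exact Finset.prod_congr rfl fun i _ => by
    rw [lintegral_indicator (hs i), withDensity_apply _ (hs i)]

/-! ### Indistinguishability: post-processing, composition, moment criteria. -/

/-- One direction of `(ε, δ)`-indistinguishability of two laws. -/
def PrivacyLE {R : Type*} [MeasurableSpace R] (μ ν : Measure R) (ε δ : ℝ) : Prop :=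
  ∀ S : Set R, MeasurableSet S →
    μ S ≤ ENNReal.ofReal (Real.exp ε) * ν S + ENNReal.ofReal δ

theorem PrivacyLE.map {R R' : Type*} [MeasurableSpace R] [MeasurableSpace R']
    {μ ν : Measure R} {ε δ : ℝ} (h : PrivacyLE μ ν ε δ) {g : R → R'} (hg : Measurable g) :
    PrivacyLE (μ.map g) (ν.map g) ε δ := by
  intro S hS
  rw [Measure.map_apply hg hS, Measure.map_apply hg hS]
  exact h _ (hg hS)

/-- Independent composition of a pure and an approximate mechanism. -/
theorem PrivacyLE.prod {R R' : Type*} [MeasurableSpace R] [MeasurableSpace R']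
    {μ μ' : Measure R} {ν ν' : Measure R'} [IsProbabilityMeasure μ] [SFinite μ']
    [IsProbabilityMeasure ν] [SFinite ν'] {ε₁ ε₂ δ : ℝ}
    (h₁ : PrivacyLE μ μ' ε₁ 0) (h₂ : PrivacyLE ν ν' ε₂ δ) :
    PrivacyLE (μ.prod ν) (μ'.prod ν') (ε₁ + ε₂) δ := by
  intro S hS
  have hle : μ ≤ ENNReal.ofReal (Real.exp ε₁) • μ' := by
    refine Measure.le_iff.2 fun T hT => ?_
    simpa using h₁ T hT
  rw [Measure.prod_apply hS, Measure.prod_apply hS]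
  -- The second coordinate is exchanged first, so that `δ` is integrated against the probability
  -- measure `μ` and is not multiplied by `e^ε₁`.
  calc ∫⁻ x, ν (Prod.mk x ⁻¹' S) ∂μ
      ≤ ∫⁻ x, (ENNReal.ofReal (Real.exp ε₂) * ν' (Prod.mk x ⁻¹' S) + ENNReal.ofReal δ) ∂μ :=
        lintegral_mono fun x => h₂ _ (measurable_prodMk_left hS)
    _ = ENNReal.ofReal (Real.exp ε₂) * ∫⁻ x, ν' (Prod.mk x ⁻¹' S) ∂μ + ENNReal.ofReal δ := by
        rw [lintegral_add_right _ measurable_const,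
          lintegral_const_mul _ (measurable_measure_prodMk_left hS)]
        simp
    _ ≤ ENNReal.ofReal (Real.exp ε₂) *
          ∫⁻ x, ν' (Prod.mk x ⁻¹' S) ∂(ENNReal.ofReal (Real.exp ε₁) • μ') +
          ENNReal.ofReal δ := by
        gcongr
    _ = _ := by
        rw [lintegral_smul_measure, smul_eq_mul, ← mul_assoc,
          ← ENNReal.ofReal_mul (Real.exp_pos _).le, ← Real.exp_add, add_comm ε₂]

/-- Pointwise `1 ≤ e^(ε - ℓ) + e^(s (ℓ - ε))`, since one of the two exponents is nonnegative. Thus a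
moment of order `s` of the privacy loss `ℓ` controls `δ`. -/
theorem privacyLE_withDensity {R : Type*} [MeasurableSpace R] (μ : Measure R) {ℓ : R → ℝ}
    (hℓ : Measurable ℓ) {ε δ s : ℝ} (hs : 0 ≤ s)
    (h : ∫⁻ x, ENNReal.ofReal (Real.exp (s * (ℓ x - ε))) ∂μ ≤ ENNReal.ofReal δ) :
    PrivacyLE μ (μ.withDensity fun x => ENNReal.ofReal (Real.exp (-ℓ x))) ε δ := by
  intro S hS
  calc μ S = ∫⁻ x in S, 1 ∂μ := by simp
    _ ≤ ∫⁻ x in S, (ENNReal.ofReal (Real.exp ε) * ENNReal.ofReal (Real.exp (-ℓ x)) +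
          ENNReal.ofReal (Real.exp (s * (ℓ x - ε)))) ∂μ := by
        refine lintegral_mono fun x => ?_
        rw [← ENNReal.ofReal_mul (Real.exp_pos _).le, ← Real.exp_add,
          ← ENNReal.ofReal_add (Real.exp_pos _).le (Real.exp_pos _).le, ← ENNReal.ofReal_one]
        refine ENNReal.ofReal_le_ofReal ?_
        rcases le_total (ℓ x) ε with hx | hx
        · linarith [Real.one_le_exp (x := ε + -ℓ x) (by linarith),
            Real.exp_pos (s * (ℓ x - ε))]
        · linarith [Real.one_le_exp (x := s * (ℓ x - ε)) (mul_nonneg hs (by linarith)),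
            Real.exp_pos (ε + -ℓ x)]
    _ = ENNReal.ofReal (Real.exp ε) *
          (μ.withDensity fun x => ENNReal.ofReal (Real.exp (-ℓ x))) S +
          ∫⁻ x in S, ENNReal.ofReal (Real.exp (s * (ℓ x - ε))) ∂μ := by
        rw [lintegral_add_left (by fun_prop), lintegral_const_mul _ (by fun_prop),
          withDensity_apply _ hS]
    _ ≤ _ := by
        gcongr
        exact (setLIntegral_le_lintegral _ _).trans h

/-- The reverse direction. The loss is now `-ℓ` and its moment is taken under the tilted law, which
costs one extra factor `e^(-ℓ)` under `μ`. -/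
theorem withDensity_privacyLE {R : Type*} [MeasurableSpace R] (μ : Measure R) {ℓ : R → ℝ}
    {ε δ s : ℝ} (hs : 0 ≤ s)
    (h : ∫⁻ x, ENNReal.ofReal (Real.exp (-ℓ x + s * (-ℓ x - ε))) ∂μ ≤ ENNReal.ofReal δ) :
    PrivacyLE (μ.withDensity fun x => ENNReal.ofReal (Real.exp (-ℓ x))) μ ε δ := by
  intro S hS
  rw [withDensity_apply _ hS]
  calc ∫⁻ x in S, ENNReal.ofReal (Real.exp (-ℓ x)) ∂μ
      ≤ ∫⁻ x in S, (ENNReal.ofReal (Real.exp ε) +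
          ENNReal.ofReal (Real.exp (-ℓ x + s * (-ℓ x - ε)))) ∂μ := by
        refine lintegral_mono fun x => ?_
        rw [← ENNReal.ofReal_add (Real.exp_pos _).le (Real.exp_pos _).le]
        refine ENNReal.ofReal_le_ofReal ?_
        rcases le_total (-ℓ x) ε with hx | hx
        · linarith [Real.exp_le_exp.2 hx, Real.exp_pos (-ℓ x + s * (-ℓ x - ε))]
        · linarith [Real.exp_le_exp.2 (show -ℓ x ≤ -ℓ x + s * (-ℓ x - ε) from
            le_add_of_nonneg_right (mul_nonneg hs (by linarith))), Real.exp_pos ε]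
    _ = ENNReal.ofReal (Real.exp ε) * μ S +
          ∫⁻ x in S, ENNReal.ofReal (Real.exp (-ℓ x + s * (-ℓ x - ε))) ∂μ := by
        rw [lintegral_add_left (by fun_prop)]
        simp
    _ ≤ _ := by
        gcongr
        exact (setLIntegral_le_lintegral _ _).trans h

/-! ### Scalar estimates for the moment exponent. -/

theorem neg_log_one_sub_le {x : ℝ} (hx : x ≤ 1 / 2) :
    -Real.log (1 - x) ≤ x + 2 * x ^ 2 := by
  have h := Real.one_sub_inv_le_log_of_pos (show 0 < 1 - x by linarith)
  have h2 : (1 - x)⁻¹ ≤ 1 + x + 2 * x ^ 2 := by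
    rw [inv_le_iff_one_le_mul₀ (by linarith)]
    nlinarith [sq_nonneg x, mul_nonneg (sq_nonneg x) (show 0 ≤ 1 - 2 * x by linarith)]
  linarith

/-- The first-order part is kept in the form `(1 + τ)⁻¹ τ` so that it cancels exactly against the
leading term of `lossExponent`. -/
theorem neg_mul_log_one_add_le {p τ s : ℝ} (hs : 0 ≤ s) (hτ : |τ| ≤ 1 / 22) (hp : |p| ≤ 2 * s) :
    -p * Real.log (1 + τ) ≤ -(p * (1 + τ)⁻¹ * τ) + 11 / 5 * (s * τ ^ 2) := by
  obtain ⟨hτ1, hτ2⟩ := abs_le.1 hτ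
  set c := (1 + τ)⁻¹ with hc
  have hcpos : 0 < c := inv_pos.2 (by linarith)
  have hc1 : c * (1 + τ) = 1 := inv_mul_cancel₀ (by linarith)
  have hc2 : c ≤ 11 / 10 := by nlinarith
  have hlog1 : c * τ ≤ Real.log (1 + τ) := by
    have := Real.one_sub_inv_le_log_of_pos (show 0 < 1 + τ by linarith)
    linarith [show c * τ = 1 - (1 + τ)⁻¹ by rw [← hc]; linarith]
  have hlog2 : Real.log (1 + τ) ≤ c * τ + c * τ ^ 2 := by
    have := Real.log_le_sub_one_of_pos (show 0 < 1 + τ by linarith)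
    linarith [show c * τ + c * τ ^ 2 = τ by linear_combination τ * hc1]
  have hd : |p * (Real.log (1 + τ) - c * τ)| ≤ 11 / 5 * (s * τ ^ 2) := by
    rw [abs_mul, abs_of_nonneg (show 0 ≤ Real.log (1 + τ) - c * τ by linarith)]
    calc |p| * (Real.log (1 + τ) - c * τ) ≤ (2 * s) * (11 / 10 * τ ^ 2) := by
          refine mul_le_mul hp ?_ (by linarith) (by linarith)
          nlinarith [sq_nonneg τ]
      _ = 11 / 5 * (s * τ ^ 2) := by ring
  have := (abs_le.1 hd).1
  linarith

/-- The exponent that appears in the moments of the privacy loss of one row. -/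
noncomputable def lossExponent (p τ v : ℝ) : ℝ :=
  p * (1 + τ)⁻¹ * τ - p * (1 + τ)⁻¹ ^ 2 * (τ ^ 2 + v) / 2 + p ^ 2 * (1 + τ)⁻¹ ^ 2 * v / 2

set_option maxHeartbeats 400000 in
-- With `A` the loss exponent and `c = (1 + τ)⁻¹`, one has `-log(1 - 2A) / 2 ≤ A + 4A²`. The linear
-- term `p c τ` of `A` cancels that of `-p log(1 + τ)`, and everything left is at most a multiple of
-- `u = s² (τ² + v)`.
theorem lossExponent_bounds {p τ v s : ℝ} (hv : 0 ≤ v) (hs : 1 ≤ s) (hp : |p| ≤ 2 * s)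
    (h : s ^ 2 * (τ ^ 2 + v) ≤ 1 / 512) :
    lossExponent p τ v ≤ 1 / 4 ∧
      -p * Real.log (1 + τ) - Real.log (1 - 2 * lossExponent p τ v) / 2 ≤
        64 * (s ^ 2 * (τ ^ 2 + v)) := by
  set u := s ^ 2 * (τ ^ 2 + v) with hu
  have hs2 : 1 ≤ s ^ 2 := by nlinarith
  have hss : s ≤ s ^ 2 := by nlinarith
  have hρ0 : 0 ≤ τ ^ 2 + v := by positivity
  have hρ : τ ^ 2 + v ≤ 1 / 512 := by nlinarith
  -- `22² = 484 < 512`.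
  have hτ : |τ| ≤ 1 / 22 := abs_le_of_sq_le_sq (by nlinarith) (by norm_num)
  obtain ⟨hτ1, hτ2⟩ := abs_le.1 hτ
  have hu0 : 0 ≤ u := by positivity
  set c := (1 + τ)⁻¹ with hc
  have hcpos : 0 < c := inv_pos.2 (by linarith)
  have hc1 : c * (1 + τ) = 1 := inv_mul_cancel₀ (by linarith)
  have hc2 : c ≤ 11 / 10 := by nlinarith
  have hcc : c ^ 2 ≤ 5 / 4 := by nlinarith
  have hsτ : |s * τ| ≤ 1 / 22 := by
    refine abs_le_of_sq_le_sq ?_ (by norm_num)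
    rw [mul_pow]; linarith [mul_nonneg (sq_nonneg s) hv]
  have hsτ2 : (s * τ) ^ 2 ≤ u := by rw [mul_pow]; linarith [mul_nonneg (sq_nonneg s) hv]
  have hsρ : s * (τ ^ 2 + v) ≤ u := mul_le_mul_of_nonneg_right hss hρ0
  have h1 : |p * c * τ| ≤ 11 / 5 * |s * τ| := by
    rw [abs_mul, abs_mul, abs_mul, abs_of_pos hcpos, abs_of_pos (show 0 < s by linarith)]
    have : |p| * c ≤ 11 / 5 * s := by
      linarith [mul_le_mul hp hc2 hcpos.le (show 0 ≤ 2 * s by linarith)]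
    linarith [mul_le_mul_of_nonneg_right this (abs_nonneg τ)]
  have h2 : |p * c ^ 2 * (τ ^ 2 + v) / 2| ≤ 5 / 4 * u := by
    rw [abs_div, abs_mul, abs_mul, abs_of_nonneg hρ0, abs_of_nonneg (sq_nonneg c),
      abs_of_pos (show (0 : ℝ) < 2 by norm_num)]
    have : |p| * c ^ 2 ≤ 5 / 2 * s := by
      linarith [mul_le_mul hp hcc (sq_nonneg c) (show 0 ≤ 2 * s by linarith)]
    linarith [mul_le_mul_of_nonneg_right this hρ0]
  have hp2 : p ^ 2 ≤ 4 * s ^ 2 := by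
    nlinarith [sq_abs p, abs_nonneg p]
  have h3 : p ^ 2 * c ^ 2 * v / 2 ≤ 5 / 2 * u := by
    have : p ^ 2 * c ^ 2 ≤ 5 * s ^ 2 := by
      linarith [mul_le_mul hp2 hcc (sq_nonneg c) (show 0 ≤ 4 * s ^ 2 by positivity)]
    linarith [mul_le_mul_of_nonneg_right this hv, mul_nonneg (sq_nonneg s) (sq_nonneg τ)]
  have h3' : 0 ≤ p ^ 2 * c ^ 2 * v / 2 := by positivity
  have hA : lossExponent p τ v =
      p * c * τ - p * c ^ 2 * (τ ^ 2 + v) / 2 + p ^ 2 * c ^ 2 * v / 2 := rfl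
  set A := lossExponent p τ v
  obtain ⟨h1a, h1b⟩ := abs_le.1 h1
  obtain ⟨h2a, h2b⟩ := abs_le.1 h2
  have hA1 : |A| ≤ 11 / 5 * |s * τ| + 15 / 4 * u := by
    rw [abs_le]; constructor <;> linarith
  have hA4 : A ≤ 1 / 4 := by
    have := (abs_le.1 hA1).2
    linarith
  refine ⟨hA4, ?_⟩
  have hA2 : A ^ 2 ≤ 10 * u := by
    have : A ^ 2 ≤ (11 / 5 * |s * τ| + 15 / 4 * u) ^ 2 := by
      rw [← sq_abs A]; gcongr
    have h4 : (11 / 5 * |s * τ| + 15 / 4 * u) ^ 2 ≤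
        2 * ((11 / 5) ^ 2 * (s * τ) ^ 2) + 2 * ((15 / 4) ^ 2 * (u * u)) := by
      have := sq_nonneg (11 / 5 * |s * τ| - 15 / 4 * u)
      rw [← sq_abs (s * τ)]
      linarith
    have h5 : u * u ≤ 1 / 512 * u := mul_le_mul_of_nonneg_right h hu0
    linarith
  have hl := neg_log_one_sub_le (show 2 * A ≤ 1 / 2 by linarith)
  have hlog := neg_mul_log_one_add_le (by linarith) hτ hp
  have hsτ3 : s * τ ^ 2 ≤ u := by nlinarith [mul_nonneg (show 0 ≤ s by linarith) hv]
  linarith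

/-! ### Gaussian exponential integrals. -/

theorem lintegral_exp_mul_gaussianReal (v : NNReal) (t : ℝ) :
    ∫⁻ x, ENNReal.ofReal (Real.exp (t * x)) ∂(gaussianReal 0 v) =
      ENNReal.ofReal (Real.exp (v * t ^ 2 / 2)) := by
  rw [← ofReal_integral_eq_lintegral_ofReal (integrable_exp_mul_gaussianReal t)
    (ae_of_all _ fun x => (Real.exp_pos _).le)]
  have h := congrFun (mgf_id_gaussianReal (μ := 0) (v := v)) t
  simp only [mgf, id] at h
  rw [h, zero_mul, zero_add]

/-- Up to the factor `(1 - 2a)^(-1/2)`, the integrand times the standard density is the density of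
variance `(1 - 2a)⁻¹`. -/
theorem lintegral_exp_mul_sq_gaussianReal {a : ℝ} (ha : a < 1 / 2) :
    ∫⁻ x, ENNReal.ofReal (Real.exp (a * x ^ 2)) ∂(gaussianReal 0 1) =
      ENNReal.ofReal (Real.exp (-Real.log (1 - 2 * a) / 2)) := by
  have hb : 0 < 1 - 2 * a := by linarith
  set v : NNReal := ⟨(1 - 2 * a)⁻¹, (inv_pos.2 hb).le⟩ with hv
  have hvc : (v : ℝ) = (1 - 2 * a)⁻¹ := rfl
  have hv0 : v ≠ 0 := by
    intro h
    have : (v : ℝ) = 0 := by rw [h]; rfl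
    rw [hvc] at this
    exact (inv_pos.2 hb).ne' this
  rw [gaussianReal_of_var_ne_zero 0 one_ne_zero,
    lintegral_withDensity_eq_lintegral_mul _ (measurable_gaussianPDF 0 1) (by fun_prop)]
  have hsq : Real.exp (-Real.log (1 - 2 * a) / 2) = (√(1 - 2 * a))⁻¹ := by
    rw [neg_div, Real.exp_neg, ← Real.log_sqrt hb.le, Real.exp_log (Real.sqrt_pos.2 hb)]
  have h : ∀ x : ℝ, (gaussianPDF 0 1 * fun x => ENNReal.ofReal (Real.exp (a * x ^ 2))) x =
      ENNReal.ofReal (Real.exp (-Real.log (1 - 2 * a) / 2)) * gaussianPDF 0 v x := by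
    intro x
    simp only [Pi.mul_apply, gaussianPDF]
    rw [← ENNReal.ofReal_mul (gaussianPDFReal_nonneg _ _ _), ← ENNReal.ofReal_mul (Real.exp_pos _).le]
    congr 1
    simp only [gaussianPDFReal, hvc, NNReal.coe_one, hsq]
    rw [mul_assoc, ← Real.exp_add, ← mul_assoc, ← mul_inv, ← Real.sqrt_mul hb.le]
    congr 2
    · congr 1; field_simp
    · field_simp; ring
  simp only [h]
  rw [lintegral_const_mul _ (measurable_gaussianPDF 0 v), lintegral_gaussianPDF_eq_one 0 hv0,
    mul_one]

/-- The standard Gaussian law on `ℝⁿ`. -/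
noncomputable abbrev gaussianVector (n : ℕ) : Measure (Fin n → ℝ) :=
  Measure.pi fun _ => gaussianReal 0 1

theorem gaussianVector_map_dotProduct {n : ℕ} (y : Fin n → ℝ) :
    (gaussianVector n).map (fun m => ∑ i, m i * y i) =
      gaussianReal 0 (∑ i, y i ^ 2).toNNReal := by
  have hm : Measurable fun m : Fin n → ℝ => ∑ i, m i * y i := by fun_prop
  have := Measure.isProbabilityMeasure_map (μ := gaussianVector n) hm.aemeasurable
  refine Measure.ext_of_charFun (funext fun t => ?_)
  rw [charFun_apply_real, integral_map hm.aemeasurable (by fun_prop), charFun_gaussianReal,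
    Real.coe_toNNReal _ (Finset.sum_nonneg fun i _ => sq_nonneg _)]
  have h : ∀ m : Fin n → ℝ, Complex.exp (t * ((∑ i, m i * y i : ℝ) : ℂ) * Complex.I) =
      ∏ i, Complex.exp (((t * y i : ℝ) : ℂ) * m i * Complex.I) := by
    intro m
    rw [← Complex.exp_sum]
    congr 1
    push_cast
    rw [Finset.mul_sum, Finset.sum_mul]
    exact Finset.sum_congr rfl fun i _ => by ring
  simp only [h]
  rw [integral_fintype_prod_eq_prod
    (f := fun (i : Fin n) (x : ℝ) => Complex.exp (((t * y i : ℝ) : ℂ) * x * Complex.I))]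
  simp only [← charFun_apply_real, charFun_gaussianReal]
  rw [← Complex.exp_sum]
  congr 1
  push_cast
  rw [Finset.sum_mul]
  simp only [Finset.sum_div, ← Finset.sum_neg_distrib, mul_zero, zero_mul, zero_sub]
  exact Finset.sum_congr rfl fun i _ => by ring

theorem gaussianVector_eq_withDensity (n : ℕ) :
    gaussianVector n = (volume : Measure (Fin n → ℝ)).withDensity fun x =>
      ENNReal.ofReal ((√(2 * Real.pi))⁻¹ ^ n * Real.exp (-(∑ i, x i ^ 2) / 2)) := by
  have h := gaussianReal_of_var_ne_zero 0 (one_ne_zero : (1 : NNReal) ≠ 0)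
  have hs : SigmaFinite (volume.withDensity (gaussianPDF 0 1)) := by rw [← h]; infer_instance
  rw [gaussianVector, h, pi_withDensity _ _ (measurable_gaussianPDF 0 1), ← volume_pi]
  congr 1
  ext x
  simp only [gaussianPDF]
  rw [← ENNReal.ofReal_prod_of_nonneg fun i _ => gaussianPDFReal_nonneg _ _ _]
  congr 1
  simp only [gaussianPDFReal, NNReal.coe_one, mul_one, sub_zero]
  rw [Finset.prod_mul_distrib, ← Real.exp_sum]
  simp [Finset.sum_div, ← Finset.sum_neg_distrib, neg_div]

/-! ### The privacy loss of one row and its moments. -/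

/-- The logarithm of the density of a standard Gaussian vector `m` with respect to the law of
`m + m i • t`. -/
noncomputable def rowLoss {n : ℕ} (i : Fin n) (t y : Fin n → ℝ) : ℝ :=
  Real.log (1 + t i) - (1 + t i)⁻¹ * (y i * ∑ j, y j * t j) +
    (1 + t i)⁻¹ ^ 2 * y i ^ 2 * (∑ j, t j ^ 2) / 2

@[fun_prop]
theorem measurable_rowLoss {n : ℕ} (i : Fin n) (t : Fin n → ℝ) : Measurable (rowLoss i t) := by
  unfold rowLoss
  fun_prop

/-- Change of variables: the map has determinant `1 + tᵢ` by the matrix determinant lemma and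
inverse `y ↦ y - (1 + tᵢ)⁻¹ yᵢ t`. Expanding the square in the pulled-back Gaussian density gives
`rowLoss`. -/
theorem gaussianVector_map_add_smul {n : ℕ} (i : Fin n) (t : Fin n → ℝ) (ht : 0 < 1 + t i) :
    (gaussianVector n).map (fun m => m + m i • t) =
      (gaussianVector n).withDensity fun y => ENNReal.ofReal (Real.exp (-rowLoss i t y)) := by
  set N : Matrix (Fin n) (Fin n) ℝ :=
    1 + Matrix.replicateCol Unit t * Matrix.replicateRow Unit (Pi.single i (1 : ℝ)) with hN
  have hdet : N.det = 1 + t i := by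
    rw [hN, Matrix.det_one_add_replicateCol_mul_replicateRow]
    simp
  have hT : ∀ m : Fin n → ℝ, Matrix.toLin' N m = m + m i • t := by
    intro m
    ext j
    simp [hN, Matrix.mulVec, dotProduct, Matrix.mul_apply,
      Matrix.replicateCol_apply, Matrix.replicateRow_apply, Pi.single_apply, mul_comm]
  have hvol := Real.map_matrix_volume_pi_eq_smul_volume_pi (M := N) (by rw [hdet]; exact ht.ne')
  rw [hdet, abs_of_pos (inv_pos.2 ht), funext hT] at hvol
  have hm : Measurable fun m : Fin n → ℝ => m + m i • t := by fun_prop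
  set c := (1 + t i)⁻¹ with hc
  have hc1 : c * (1 + t i) = 1 := inv_mul_cancel₀ ht.ne'
  set K := (√(2 * Real.pi))⁻¹ ^ n with hK
  have hK0 : 0 ≤ K := by positivity
  set φ : (Fin n → ℝ) → ENNReal := fun x =>
    ENNReal.ofReal (K * Real.exp (-(∑ j, x j ^ 2) / 2)) with hφ
  have hφm : Measurable φ := by fun_prop
  set ψ : (Fin n → ℝ) → ENNReal := fun y => φ (y - (c * y i) • t) with hψ
  have hψm : Measurable ψ := by
    refine hφm.comp ?_
    fun_prop
  have hγ : gaussianVector n = volume.withDensity φ := gaussianVector_eq_withDensity n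
  have hψT : ∀ x : Fin n → ℝ, ψ (x + x i • t) = φ x := by
    intro x
    simp only [hψ]
    congr 1
    ext j
    simp only [Pi.sub_apply, Pi.add_apply, Pi.smul_apply, smul_eq_mul]
    linear_combination (-(x i * t j)) * hc1
  rw [hγ, ← withDensity_mul _ hφm (by fun_prop)]
  ext S hS
  rw [Measure.map_apply hm hS, withDensity_apply _ (hm hS), withDensity_apply _ hS]
  calc ∫⁻ x in (fun m => m + m i • t) ⁻¹' S, φ x
      = ∫⁻ x in (fun m => m + m i • t) ⁻¹' S, ψ (x + x i • t) := by simp only [hψT]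
    _ = ∫⁻ y in S, ψ y ∂(volume.map fun m : Fin n → ℝ => m + m i • t) :=
        (setLIntegral_map hS hψm hm).symm
    _ = ∫⁻ y in S, ENNReal.ofReal c * ψ y := by
        rw [hvol, setLIntegral_smul_measure, lintegral_const_mul _ hψm]
        rfl
    _ = _ := by
        refine lintegral_congr fun y => ?_
        simp only [hψ, hφ, Pi.mul_apply]
        rw [← ENNReal.ofReal_mul (inv_pos.2 ht).le, ← ENNReal.ofReal_mul (by positivity)]
        congr 1
        have hcl : c = Real.exp (-Real.log (1 + t i)) := by
          rw [Real.exp_neg, Real.exp_log ht]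
        rw [mul_left_comm, mul_assoc]
        congr 1
        rw [show c * Real.exp (-(∑ j, (y - (c * y i) • t) j ^ 2) / 2) =
          Real.exp (-Real.log (1 + t i)) * Real.exp (-(∑ j, (y - (c * y i) • t) j ^ 2) / 2) by
            rw [← hcl], ← Real.exp_add, ← Real.exp_add]
        congr 1
        have hsum : ∑ j, (y - (c * y i) • t) j ^ 2 =
            ∑ j, y j ^ 2 - 2 * (c * y i) * ∑ j, y j * t j + (c * y i) ^ 2 * ∑ j, t j ^ 2 := by
          rw [Finset.mul_sum, Finset.mul_sum, ← Finset.sum_sub_distrib, ← Finset.sum_add_distrib]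
          refine Finset.sum_congr rfl fun j _ => ?_
          simp only [Pi.sub_apply, Pi.smul_apply, smul_eq_mul]
          ring
        rw [hsum]
        simp only [rowLoss, ← hc]
        ring

/-- For fixed `yᵢ = g` the loss is affine in `∑ yⱼ tⱼ` over `j ≠ i`, a centered Gaussian of variance
`‖t‖² - tᵢ²`. Integrating it out leaves the exponential of a constant plus `lossExponent * g²`. -/
theorem lintegral_exp_rowLoss {n : ℕ} (i : Fin n) (t : Fin n → ℝ) (p : ℝ)
    (hp : lossExponent p (t i) (∑ j, t j ^ 2 - t i ^ 2) < 1 / 2) :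
    ∫⁻ y, ENNReal.ofReal (Real.exp (-p * rowLoss i t y)) ∂(gaussianVector n) =
      ENNReal.ofReal (Real.exp (-p * Real.log (1 + t i) -
        Real.log (1 - 2 * lossExponent p (t i) (∑ j, t j ^ 2 - t i ^ 2)) / 2)) := by
  obtain ⟨k, rfl⟩ : ∃ k, n = k + 1 := ⟨n - 1, by have := i.pos; omega⟩
  set τ := t i with hτ
  set v := ∑ j : Fin k, t (i.succAbove j) ^ 2 with hv
  have hv0 : 0 ≤ v := Finset.sum_nonneg fun _ _ => sq_nonneg _
  have hsum : ∑ j, t j ^ 2 = τ ^ 2 + v := Fin.sum_univ_succAbove _ i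
  rw [hsum, add_sub_cancel_left] at hp ⊢
  set c := (1 + τ)⁻¹ with hc
  rw [← ((measurePreserving_piFinSuccAbove (fun _ => gaussianReal 0 1) i).symm).lintegral_comp
    (by fun_prop)]
  have hloss : ∀ z : ℝ × (Fin k → ℝ),
      -p * rowLoss i t ((MeasurableEquiv.piFinSuccAbove (fun _ => ℝ) i).symm z) =
      -p * Real.log (1 + τ) + (p * c * τ - p * c ^ 2 * (τ ^ 2 + v) / 2) * z.1 ^ 2 +
        (p * c * z.1) * ∑ j, z.2 j * t (i.succAbove j) := by
    intro z
    simp only [rowLoss, Fin.sum_univ_succAbove _ i, MeasurableEquiv.piFinSuccAbove,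
      Fin.insertNthEquiv]
    simp only [MeasurableEquiv.symm_mk, MeasurableEquiv.coe_mk, Equiv.symm_symm, Equiv.coe_fn_mk,
      Fin.insertNth_apply_same, Fin.insertNth_apply_succAbove, ← hτ, ← hc, ← hv]
    ring
  simp only [hloss]
  rw [lintegral_prod _ (by fun_prop)]
  have hinner : ∀ g : ℝ, ∫⁻ y, ENNReal.ofReal (Real.exp (-p * Real.log (1 + τ) +
      (p * c * τ - p * c ^ 2 * (τ ^ 2 + v) / 2) * g ^ 2 +
        (p * c * g) * ∑ j, y j * t (i.succAbove j))) ∂(gaussianVector k) =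
      ENNReal.ofReal (Real.exp (-p * Real.log (1 + τ))) *
        ENNReal.ofReal (Real.exp (lossExponent p τ v * g ^ 2)) := by
    intro g
    simp only [Real.exp_add, ENNReal.ofReal_mul (Real.exp_pos _).le,
      ENNReal.ofReal_mul (mul_pos (Real.exp_pos _) (Real.exp_pos _)).le]
    rw [lintegral_const_mul _ (by fun_prop),
      ← lintegral_map (f := fun x : ℝ => ENNReal.ofReal (Real.exp (p * c * g * x)))
        (g := fun y : Fin k → ℝ => ∑ j, y j * t (i.succAbove j)) (by fun_prop) (by fun_prop),
      gaussianVector_map_dotProduct, lintegral_exp_mul_gaussianReal, Real.coe_toNNReal _ hv0,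
      mul_assoc, ← ENNReal.ofReal_mul (Real.exp_pos _).le, ← Real.exp_add]
    congr 3
    simp only [lossExponent, ← hc]
    ring
  simp only [hinner]
  rw [lintegral_const_mul _ (by fun_prop), lintegral_exp_mul_sq_gaussianReal hp,
    ← ENNReal.ofReal_mul (Real.exp_pos _).le, ← Real.exp_add]
  congr 2
  ring

/-! ### Singular values of neighboring matrices. -/

theorem least_eigenvalue_mul_norm_sq_le {E : Type*} [NormedAddCommGroup E] [InnerProductSpace ℝ E]
    [FiniteDimensional ℝ E] {T : E →ₗ[ℝ] E} (hT : T.IsSymmetric) {n : ℕ}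
    (hn : Module.finrank ℝ E = n) {c : ℝ} (hc : ∀ i, c ≤ hT.eigenvalues hn i) (x : E) :
    c * ‖x‖ ^ 2 ≤ inner ℝ (T x) x := by
  set b := hT.eigenvectorBasis hn with hb
  rw [← b.sum_inner_mul_inner (T x) x, ← b.sum_sq_norm_inner_right x, Finset.mul_sum]
  refine Finset.sum_le_sum fun i _ => ?_
  rw [hT x (b i), hT.apply_eigenvectorBasis hn i]
  simp only [RCLike.ofReal_real_eq_id, id, inner_smul_right, Real.norm_eq_abs, sq_abs]
  rw [← hb, real_inner_comm x (b i)]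
  nlinarith [mul_le_mul_of_nonneg_right (hc i) (sq_nonneg (inner ℝ x (b i)))]

theorem le_norm_of_le_singularValues {E F : Type*} [NormedAddCommGroup E] [InnerProductSpace ℝ E]
    [FiniteDimensional ℝ E] [NormedAddCommGroup F] [InnerProductSpace ℝ F]
    [FiniteDimensional ℝ F] (T : E →ₗ[ℝ] F) {c : ℝ} (hc0 : 0 ≤ c)
    (hc : ∀ i < Module.finrank ℝ E, c ≤ T.singularValues i) (x : E) : c * ‖x‖ ≤ ‖T x‖ := by
  refine le_of_sq_le_sq ?_ (norm_nonneg _)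
  rw [mul_pow, ← real_inner_self_eq_norm_sq (T x), ← LinearMap.adjoint_inner_left]
  refine least_eigenvalue_mul_norm_sq_le T.isSymmetric_adjoint_comp_self rfl (fun i => ?_) x
  rw [← T.sq_singularValues_fin rfl i]
  exact pow_le_pow_left₀ hc0 (hc i i.isLt) 2

theorem exists_norm_eq_singularValues {E F : Type*} [NormedAddCommGroup E] [InnerProductSpace ℝ E]
    [FiniteDimensional ℝ E] [NormedAddCommGroup F] [InnerProductSpace ℝ F]
    [FiniteDimensional ℝ F] (T : E →ₗ[ℝ] F) {i : ℕ} (hi : i < Module.finrank ℝ E) :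
    ∃ x : E, ‖x‖ = 1 ∧ ‖T x‖ = T.singularValues i := by
  set b := T.isSymmetric_adjoint_comp_self.eigenvectorBasis rfl
  refine ⟨b ⟨i, hi⟩, b.norm_eq_one _, ?_⟩
  rw [← sq_eq_sq₀ (norm_nonneg _) (T.singularValues_nonneg i),
    ← real_inner_self_eq_norm_sq (T _), ← LinearMap.adjoint_inner_left,
    T.sq_singularValues_of_lt rfl hi, ← LinearMap.comp_apply,
    T.isSymmetric_adjoint_comp_self.apply_eigenvectorBasis rfl]
  simp [inner_smul_left, b]

theorem NeighboringMatrices.symm {n d : ℕ} {A A' : Matrix (Fin n) (Fin d) ℝ}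
    (h : NeighboringMatrices A A') : NeighboringMatrices A' A := by
  obtain ⟨i, h1, h2⟩ := h
  refine ⟨i, fun j hj k => (h1 j hj k).symm, ?_⟩
  simpa only [sub_sq_comm] using h2

theorem sv_nonneg {n d : ℕ} (A : Matrix (Fin n) (Fin d) ℝ) (i : ℕ) : 0 ≤ sv A i :=
  LinearMap.singularValues_nonneg _ i

theorem leastSV_le_sv {n d : ℕ} (A : Matrix (Fin n) (Fin d) ℝ) (i : Fin d) : leastSV A ≤ sv A i :=
  LinearMap.singularValues_antitone _ (by omega)

theorem le_norm_of_le_sv {n d : ℕ} (A : Matrix (Fin n) (Fin d) ℝ) {c : ℝ} (hc0 : 0 ≤ c)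
    (hc : ∀ i : Fin d, c ≤ sv A i) (x : EuclideanSpace ℝ (Fin d)) :
    c * ‖x‖ ≤ ‖Matrix.toEuclideanLin A x‖ :=
  le_norm_of_le_singularValues _ hc0 (fun i hi => hc ⟨i, by simpa using hi⟩) x

theorem NeighboringMatrices.norm_sub_apply_le {n d : ℕ} {A A' : Matrix (Fin n) (Fin d) ℝ}
    (h : NeighboringMatrices A A') (x : EuclideanSpace ℝ (Fin d)) :
    ‖Matrix.toEuclideanLin A x - Matrix.toEuclideanLin A' x‖ ≤ ‖x‖ := by
  obtain ⟨i, h1, h2⟩ := h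
  refine le_of_sq_le_sq ?_ (norm_nonneg _)
  rw [EuclideanSpace.real_norm_sq_eq, EuclideanSpace.real_norm_sq_eq]
  have h3 : ∀ j, (Matrix.toEuclideanLin A x - Matrix.toEuclideanLin A' x) j =
      ∑ k, (A j k - A' j k) * x k := by
    intro j
    simp [Matrix.toLpLin_apply, Matrix.mulVec, dotProduct, sub_mul, Finset.sum_sub_distrib]
  rw [Finset.sum_eq_single i _ (by simp), h3]
  · refine (Finset.sum_mul_sq_le_sq_mul_sq _ _ _).trans ?_
    exact mul_le_of_le_one_left (Finset.sum_nonneg fun _ _ => sq_nonneg _) h2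
  · intro j _ hj
    rw [h3]
    simp [h1 j hj]

/-- Test both matrices on a unit right singular vector of `A'` for its least singular value;
neighbors differ by an operator of norm at most 1. -/
theorem NeighboringMatrices.leastSV_le {n d : ℕ} {A A' : Matrix (Fin n) (Fin d) ℝ}
    (h : NeighboringMatrices A A') : leastSV A ≤ leastSV A' + 1 := by
  rcases Nat.eq_zero_or_pos d with rfl | hd
  · have : leastSV A = 0 := LinearMap.singularValues_of_finrank_le _ (by simp)
    linarith [sv_nonneg A' (0 - 1), show leastSV A' = sv A' (0 - 1) from rfl]
  · obtain ⟨x, hx, hx'⟩ := exists_norm_eq_singularValues (Matrix.toEuclideanLin A') (i := d - 1)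
      (by simpa using hd)
    have h1 := le_norm_of_le_sv A (sv_nonneg A (d - 1)) (leastSV_le_sv A) x
    have h2 := h.norm_sub_apply_le x
    have h3 := norm_sub_norm_le (Matrix.toEuclideanLin A x) (Matrix.toEuclideanLin A' x)
    rw [hx] at h1 h2
    change sv A (d - 1) ≤ sv A' (d - 1) + 1
    rw [sv, sv] at *
    linarith

/-- Solve `Aᵀ A x = v` for the row difference `v` and put `t = A x`. Then `‖t‖² = ⟨v, x⟩ ≤ ‖x‖ ≤ ‖t‖
/ w`, so `w ‖t‖ ≤ 1`. -/
theorem NeighboringMatrices.exists_eq_add {n d : ℕ} {A A' : Matrix (Fin n) (Fin d) ℝ}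
    (h : NeighboringMatrices A A') {w : ℝ} (hw : 0 < w) (hA : ∀ i : Fin d, w ≤ sv A i) :
    ∃ (i : Fin n) (t : Fin n → ℝ), w ^ 2 * ∑ j, t j ^ 2 ≤ 1 ∧
      ∀ j k, A' j k = A j k + (if j = i then ∑ l, t l * A l k else 0) := by
  have hlow := le_norm_of_le_sv A hw.le hA
  obtain ⟨i, h1, h2⟩ := h
  set T := Matrix.toEuclideanLin A with hT
  set S := LinearMap.adjoint T ∘ₗ T with hS
  set v : EuclideanSpace ℝ (Fin d) := WithLp.toLp 2 fun k => A' i k - A i k with hv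
  have hinj : Function.Injective S := by
    rw [injective_iff_map_eq_zero]
    intro x hx
    have hTx : ‖T x‖ ^ 2 = 0 := by
      rw [← real_inner_self_eq_norm_sq, ← LinearMap.adjoint_inner_left, ← LinearMap.comp_apply,
        ← hS, hx, inner_zero_left]
    have hx0 := hlow x
    rw [pow_eq_zero_iff two_ne_zero] at hTx
    rw [hTx] at hx0
    exact norm_le_zero_iff.1 (by nlinarith [norm_nonneg x])
  obtain ⟨x, hx⟩ := LinearMap.injective_iff_surjective.1 hinj v
  have hv1 : ‖v‖ ≤ 1 := by
    refine le_of_sq_le_sq ?_ zero_le_one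
    rw [EuclideanSpace.real_norm_sq_eq, one_pow]
    simpa only [hv, sub_sq_comm] using h2
  have hTx : w * ‖T x‖ ≤ 1 := by
    have h3 : ‖T x‖ ^ 2 ≤ ‖x‖ := by
      rw [← real_inner_self_eq_norm_sq, ← LinearMap.adjoint_inner_left, ← LinearMap.comp_apply,
        ← hS, hx]
      refine (real_inner_le_norm _ _).trans ?_
      exact mul_le_of_le_one_left (norm_nonneg _) hv1
    rcases (norm_nonneg (T x)).eq_or_lt with h0 | h0
    · rw [← h0]; simp
    · have := hlow x
      have h4 : (w * ‖T x‖) * ‖T x‖ ≤ 1 * ‖T x‖ := by nlinarith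
      exact le_of_mul_le_mul_right h4 h0
  refine ⟨i, T x, ?_, fun j k => ?_⟩
  · rw [← EuclideanSpace.real_norm_sq_eq, ← mul_pow]
    exact pow_le_one₀ (by positivity) hTx
  · split_ifs with hj
    · subst hj
      have h5 : v k = ∑ l, T x l * A l k := by
        rw [← hx, hS, LinearMap.comp_apply, hT, ← Matrix.toEuclideanLin_conjTranspose_eq_adjoint]
        generalize Matrix.toEuclideanLin A x = z
        simp [Matrix.toLpLin_apply, Matrix.mulVec, dotProduct, mul_comm]
      rw [← h5]
      simp [hv]
    · rw [add_zero, h1 j hj k]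

/-! ### Privacy of the Gaussian release. -/

theorem gaussianMatrix_map_add_smul {n : ℕ} (r : ℕ) (i : Fin n) (t : Fin n → ℝ)
    (ht : 0 < 1 + t i) :
    (gaussianMatrix r n).map (fun M a => M a + M a i • t) =
      (gaussianMatrix r n).withDensity fun M =>
        ENNReal.ofReal (Real.exp (-∑ a, rowLoss i t (M a))) := by
  have hm : Measurable fun m : Fin n → ℝ => m + m i • t := by fun_prop
  have hp : IsProbabilityMeasure ((gaussianVector n).map fun m => m + m i • t) :=
    Measure.isProbabilityMeasure_map hm.aemeasurable
  have h := Measure.pi_map_pi (ι := Fin r) (μ := fun _ => gaussianVector n)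
    (f := fun _ m => m + m i • t) fun _ => hm.aemeasurable
  rw [gaussianMatrix, h]
  rw [gaussianVector_map_add_smul i t ht] at hp ⊢
  rw [pi_withDensity _ _ (by fun_prop)]
  congr 1
  ext M
  rw [← ENNReal.ofReal_prod_of_nonneg fun a _ => (Real.exp_pos _).le, ← Real.exp_sum,
    Finset.sum_neg_distrib]

theorem lintegral_exp_sum_rowLoss_le {n : ℕ} (r : ℕ) (i : Fin n) (t : Fin n → ℝ) {p s : ℝ}
    (hs : 1 ≤ s) (hp : |p| ≤ 2 * s) (ht : s ^ 2 * ∑ j, t j ^ 2 ≤ 1 / 512) :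
    ∫⁻ M, ENNReal.ofReal (Real.exp (-p * ∑ a, rowLoss i t (M a))) ∂(gaussianMatrix r n) ≤
      ENNReal.ofReal (Real.exp (64 * r * (s ^ 2 * ∑ j, t j ^ 2))) := by
  have hv : 0 ≤ ∑ j, t j ^ 2 - t i ^ 2 := sub_nonneg.2
    (Finset.single_le_sum (f := fun j => t j ^ 2) (fun _ _ => sq_nonneg _) (Finset.mem_univ i))
  have hb := lossExponent_bounds (τ := t i) hv hs hp (by rwa [add_sub_cancel])
  rw [add_sub_cancel] at hb
  have hprod : ∀ M : Fin r → Fin n → ℝ,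
      ENNReal.ofReal (Real.exp (-p * ∑ a, rowLoss i t (M a))) =
        ∏ a, ENNReal.ofReal (Real.exp (-p * rowLoss i t (M a))) := by
    intro M
    rw [Finset.mul_sum, Real.exp_sum,
      ENNReal.ofReal_prod_of_nonneg fun a _ => (Real.exp_pos _).le]
  simp only [hprod]
  rw [gaussianMatrix, lintegral_fin_prod_eq_prod (fun _ : Fin r => gaussianVector n)
    (fun _ m => ENNReal.ofReal (Real.exp (-p * rowLoss i t m))) (fun _ => by fun_prop),
    lintegral_exp_rowLoss i t p (by linarith [hb.1]), Finset.prod_const, Finset.card_univ,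
    Fintype.card_fin, ← ENNReal.ofReal_pow (Real.exp_pos _).le, ← Real.exp_nat_mul]
  refine ENNReal.ofReal_le_ofReal (Real.exp_le_exp.2 ?_)
  calc _ ≤ (r : ℝ) * (64 * (s ^ 2 * ∑ j, t j ^ 2)) :=
        mul_le_mul_of_nonneg_left hb.2 (Nat.cast_nonneg r)
    _ = _ := by ring

theorem gaussianMatrix_privacyLE {n : ℕ} (r : ℕ) (i : Fin n) (t : Fin n → ℝ) {s ε δ : ℝ}
    (hs : 1 ≤ s) (ht : s ^ 2 * ∑ j, t j ^ 2 ≤ 1 / 512) (hδ : 0 < δ)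
    (h : 64 * r * (s ^ 2 * ∑ j, t j ^ 2) - s * ε ≤ Real.log δ) :
    PrivacyLE (gaussianMatrix r n) ((gaussianMatrix r n).map fun M a => M a + M a i • t) ε δ ∧
    PrivacyLE ((gaussianMatrix r n).map fun M a => M a + M a i • t) (gaussianMatrix r n) ε δ := by
  have hti : 0 < 1 + t i := by
    have h1 : t i ^ 2 ≤ ∑ j, t j ^ 2 := Finset.single_le_sum (f := fun j => t j ^ 2)
      (fun _ _ => sq_nonneg _) (Finset.mem_univ i)
    have h2 : (1 : ℝ) ≤ s ^ 2 := by nlinarith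
    nlinarith [sq_nonneg (t i)]
  have hmeas : Measurable fun M : Fin r → Fin n → ℝ => ∑ a, rowLoss i t (M a) := by fun_prop
  have key : ∀ p : ℝ, |p| ≤ 2 * s →
      ∫⁻ M, ENNReal.ofReal (Real.exp (-(s * ε) + -p * ∑ a, rowLoss i t (M a)))
        ∂(gaussianMatrix r n) ≤ ENNReal.ofReal δ := by
    intro p hp
    simp only [Real.exp_add, ENNReal.ofReal_mul (Real.exp_pos _).le]
    rw [lintegral_const_mul _ (by fun_prop)]
    refine (mul_le_mul_right (lintegral_exp_sum_rowLoss_le r i t hs hp ht) _).trans ?_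
    rw [← ENNReal.ofReal_mul (Real.exp_pos _).le, ← Real.exp_add]
    refine ENNReal.ofReal_le_ofReal ?_
    rw [← Real.exp_log hδ]
    exact Real.exp_le_exp.2 (by linarith)
  rw [gaussianMatrix_map_add_smul r i t hti]
  constructor
  -- The two directions use `p = -s` and `p = 1 + s`; both satisfy `|p| ≤ 2 s` because `s ≥ 1`.
  · refine privacyLE_withDensity _ hmeas (show 0 ≤ s by linarith) (le_trans (le_of_eq ?_)
      (key (-s) (by rw [abs_neg, abs_of_pos] <;> linarith)))
    congr 1; ext M; congr 2; ring
  · refine withDensity_privacyLE _ (show 0 ≤ s by linarith) (le_trans (le_of_eq ?_)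
      (key (1 + s) (by rw [abs_of_pos] <;> linarith)))
    congr 1; ext M; congr 2; ring

theorem log_two_div_add_two_le {δ : ℝ} (hδ : 0 < δ) {r : ℕ} (hr : 1 ≤ r) :
    Real.log (2 / δ) + 2 ≤ Real.log (16 * r / δ) := by
  have hr' : (1 : ℝ) ≤ r := by exact_mod_cast hr
  have h : Real.log (16 / δ) ≤ Real.log (16 * r / δ) := by
    refine Real.log_le_log (by positivity) ?_
    gcongr
    linarith
  have h2 : Real.log (16 / δ) = 3 * Real.log 2 + Real.log (2 / δ) := by
    rw [show (16 : ℝ) / δ = 2 ^ 3 * (2 / δ) by ring, Real.log_mul (by norm_num) (by positivity),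
      Real.log_pow]
    norm_num
  linarith [Real.log_two_gt_d9]

theorem threshold_pos {ε δ : ℝ} (hε : 0 < ε) (hδ : 0 < δ) (hεδ : ε ≤ 2 * Real.log (2 / δ))
    {r : ℕ} (hr : 1 ≤ r) : 0 < threshold ε δ r := by
  have h := log_two_div_add_two_le hδ hr
  have hL : 0 < Real.log (2 / δ) := by linarith
  have hr' : (0 : ℝ) < r := by exact_mod_cast hr
  have hs : 0 < √(r * Real.log (2 / δ)) := Real.sqrt_pos.2 (mul_pos hr' hL)
  unfold threshold
  exact mul_pos (by positivity) (by linarith)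

theorem threshold_nonneg {ε δ : ℝ} (hε : 0 < ε) (hδ : 0 < δ) (hεδ : ε ≤ 2 * Real.log (2 / δ))
    (r : ℕ) : 0 ≤ threshold ε δ r := by
  rcases Nat.eq_zero_or_pos r with rfl | hr
  · simp [threshold]
  · exact (threshold_pos hε hδ hεδ hr).le

theorem gaussianMatrix_privacyLE_of_threshold {n r : ℕ} (hr : 1 ≤ r) (i : Fin n) (t : Fin n → ℝ)
    {ε δ : ℝ} (hε : 0 < ε) (hδ : 0 < δ) (hεδ : ε ≤ 2 * Real.log (2 / δ))
    (ht : threshold ε δ r ^ 2 * ∑ j, t j ^ 2 ≤ 1) :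
    PrivacyLE (gaussianMatrix r n) ((gaussianMatrix r n).map fun M a => M a + M a i • t) ε δ ∧
    PrivacyLE ((gaussianMatrix r n).map fun M a => M a + M a i • t) (gaussianMatrix r n) ε δ := by
  have hQ := log_two_div_add_two_le hδ hr
  have hr' : (1 : ℝ) ≤ r := by exact_mod_cast hr
  have hlogδ : Real.log (2 / δ) = Real.log 2 - Real.log δ := Real.log_div (by norm_num) hδ.ne'
  rw [threshold] at ht
  set L := Real.log (2 / δ)
  set Q := Real.log (16 * r / δ)
  have hL : 0 < L := by linarith
  set P := ∑ j, t j ^ 2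
  have hP : 0 ≤ P := Finset.sum_nonneg fun _ _ => sq_nonneg _
  have hu : 64 * r * Q ^ 2 * ((2 * L / ε) ^ 2 * P) ≤ L := by
    have h1 : (16 * √(r * L) / ε * Q) ^ 2 * P = 256 * (r * L) / ε ^ 2 * Q ^ 2 * P := by
      rw [mul_pow, div_pow, mul_pow, Real.sq_sqrt (by positivity)]
      norm_num
    rw [h1] at ht
    calc 64 * r * Q ^ 2 * ((2 * L / ε) ^ 2 * P)
        = L * (256 * (r * L) / ε ^ 2 * Q ^ 2 * P) := by ring
      _ ≤ L * 1 := by gcongr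
      _ = L := mul_one L
  set u := (2 * L / ε) ^ 2 * P with hu_def
  have hu0 : 0 ≤ u := by positivity
  have hQ4 : 4 ≤ Q ^ 2 := by nlinarith
  -- `(L + 2)² - 8 L = (L - 2)²`.
  have hQL : 8 * L ≤ Q ^ 2 := by nlinarith [sq_nonneg (L - 2)]
  have hru : u ≤ r * u := le_mul_of_one_le_left hu0 hr'
  -- This order gives `s ε = 2 L`, where `-L = log δ - log 2`, so the moments may use up `L + log
  -- 2`. The condition `ε ≤ 2 ln(2/δ)` says exactly that `s ≥ 1`.
  refine gaussianMatrix_privacyLE r i t (s := 2 * L / ε) ((one_le_div hε).2 hεδ) ?_ hδ ?_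
  · have h2 : 8 * L * (r * u) ≤ Q ^ 2 * (r * u) := by gcongr
    have h3 : L * (512 * (r * u)) ≤ L * 1 := by linarith
    have := le_of_mul_le_mul_left h3 hL
    linarith
  · have h2 : 4 * (r * u) ≤ Q ^ 2 * (r * u) := by gcongr
    have h3 : 2 * L / ε * ε = 2 * L := div_mul_cancel₀ _ hε.ne'
    linarith [Real.log_two_gt_d9]

/-- Right multiplication by `A`, as a map between function spaces. -/
def rightMul (r : ℕ) {n d : ℕ} (A : Matrix (Fin n) (Fin d) ℝ) (M : Fin r → Fin n → ℝ) :
    Fin r → Fin d → ℝ :=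
  fun a k => ∑ l, M a l * A l k

@[fun_prop]
theorem measurable_rightMul (r : ℕ) {n d : ℕ} (A : Matrix (Fin n) (Fin d) ℝ) :
    Measurable (rightMul r A) := by
  unfold rightMul
  fun_prop

theorem gaussianRelease_eq_map (r : ℕ) {n d : ℕ} (A : Matrix (Fin n) (Fin d) ℝ) :
    gaussianRelease r A = (gaussianMatrix r n).map (rightMul r A) :=
  rfl

theorem NeighboringMatrices.gaussianRelease_privacyLE {n d r : ℕ}
    {A A' : Matrix (Fin n) (Fin d) ℝ} (h : NeighboringMatrices A A') {ε δ : ℝ} (hε : 0 < ε)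
    (hδ : 0 < δ) (hεδ : ε ≤ 2 * Real.log (2 / δ)) (hA : ∀ i : Fin d, threshold ε δ r ≤ sv A i) :
    PrivacyLE (gaussianRelease r A) (gaussianRelease r A') ε δ ∧
      PrivacyLE (gaussianRelease r A') (gaussianRelease r A) ε δ := by
  rcases Nat.eq_zero_or_pos r with rfl | hr
  -- For `r = 0` the threshold is `0` and yields no factorization, but the output carries no
  -- information.
  · have heq : gaussianRelease 0 A = gaussianRelease 0 A' := by
      unfold gaussianRelease
      congr 1
      ext M a
      exact a.elim0
    have hle : PrivacyLE (gaussianRelease 0 A') (gaussianRelease 0 A') ε δ := fun S _ =>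
      le_add_right (le_mul_of_one_le_left' (ENNReal.one_le_ofReal.2 (Real.one_le_exp hε.le)))
    rw [heq]
    exact ⟨hle, hle⟩
  · obtain ⟨i, t, ht, hAt⟩ := h.exists_eq_add (threshold_pos hε hδ hεδ hr) hA
    have hF : Measurable fun (M : Fin r → Fin n → ℝ) a => M a + M a i • t := by fun_prop
    have hrel : gaussianRelease r A' =
        ((gaussianMatrix r n).map fun M a => M a + M a i • t).map (rightMul r A) := by
      rw [Measure.map_map (measurable_rightMul r A) hF, gaussianRelease_eq_map]
      congr 1
      ext M a k
      simp only [Function.comp, rightMul, hAt, Pi.add_apply,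
        Pi.smul_apply, smul_eq_mul, mul_add, add_mul, Finset.sum_add_distrib, mul_ite, mul_zero,
        Finset.sum_ite_eq', Finset.mem_univ, if_true]
      rw [Finset.mul_sum]
      congr 1
      exact Finset.sum_congr rfl fun l _ => by ring
    obtain ⟨h1, h2⟩ := gaussianMatrix_privacyLE_of_threshold hr i t hε hδ hεδ ht
    rw [hrel, gaussianRelease_eq_map]
    exact ⟨h1.map (measurable_rightMul r A), h2.map (measurable_rightMul r A)⟩

/-! ### Laplace noise and composition. -/

theorem isProbabilityMeasure_laplace {b : ℝ} (hb : 0 < b) : IsProbabilityMeasure (laplace b) := by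
  have h1 : ∫ t : ℝ, Real.exp (-|t| / b) / (2 * b) = 1 := by
    rw [integral_comp_abs (f := fun t => Real.exp (-t / b) / (2 * b)), integral_div]
    have h2 : ∀ t : ℝ, Real.exp (-t / b) = Real.exp (-b⁻¹ * t) := fun t => by
      congr 1; field_simp
    simp only [h2]
    rw [integral_exp_mul_Ioi (by simpa using hb)]
    simp
    field_simp
  constructor
  rw [laplace, withDensity_apply _ MeasurableSet.univ, setLIntegral_univ,
    ← ofReal_integral_eq_lintegral_ofReal (integrable_of_integral_eq_one h1)
      (ae_of_all _ fun t => by positivity), h1, ENNReal.ofReal_one]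

theorem laplace_map_add_le {b : ℝ} (hb : 0 < b) (x y : ℝ) :
    PrivacyLE ((laplace b).map fun t => x + t) ((laplace b).map fun t => y + t) (|x - y| / b) 0 := by
  have key : ∀ z : ℝ, ∀ S : Set ℝ, MeasurableSet S → ((laplace b).map fun t => z + t) S =
      ∫⁻ u in S, ENNReal.ofReal (Real.exp (-|u - z| / b) / (2 * b)) := by
    intro z S hS
    have hm : Measurable fun t : ℝ => z + t := by fun_prop
    rw [Measure.map_apply hm hS, laplace, withDensity_apply _ (hm hS),
      ← lintegral_indicator (hm hS), ← lintegral_indicator hS,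
      ← lintegral_add_left_eq_self (S.indicator _) z]
    congr 1
    ext t
    simp only [Set.indicator, add_sub_cancel_left]
    rfl
  intro S hS
  rw [key x S hS, key y S hS, ENNReal.ofReal_zero, add_zero, ← lintegral_const_mul _ (by fun_prop)]
  refine lintegral_mono fun u => ?_
  rw [← ENNReal.ofReal_mul (Real.exp_pos _).le]
  refine ENNReal.ofReal_le_ofReal ?_
  rw [← mul_div_assoc, ← Real.exp_add, ← add_div]
  gcongr
  have := abs_sub_abs_le_abs_sub (u - y) (u - x)
  rw [show u - y - (u - x) = x - y by ring] at this
  linarith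

theorem PrivacyLE.mono_left {R : Type*} [MeasurableSpace R] {μ ν : Measure R} {ε ε' δ : ℝ}
    (h : PrivacyLE μ ν ε δ) (hε : ε ≤ ε') : PrivacyLE μ ν ε' δ := by
  intro S hS
  refine (h S hS).trans ?_
  gcongr

theorem NeighboringMatrices.leastSVRelease_privacyLE {n d : ℕ} {A A' : Matrix (Fin n) (Fin d) ℝ}
    (h : NeighboringMatrices A A') {ε : ℝ} (hε : 0 < ε) :
    PrivacyLE (leastSVRelease ε A) (leastSVRelease ε A') ε 0 := by
  refine (laplace_map_add_le (one_div_pos.2 hε) (leastSV A) (leastSV A')).mono_left ?_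
  rw [div_div_eq_mul_div, div_one]
  refine mul_le_of_le_one_left hε.le (abs_le.2 ⟨?_, ?_⟩)
  · linarith [h.symm.leastSV_le]
  · linarith [h.leastSV_le]

instance isProbabilityMeasure_gaussianRelease (r : ℕ) {n d : ℕ} (A : Matrix (Fin n) (Fin d) ℝ) :
    IsProbabilityMeasure (gaussianRelease r A) := by
  have : IsProbabilityMeasure (gaussianMatrix r n) := by unfold gaussianMatrix; infer_instance
  exact Measure.isProbabilityMeasure_map (measurable_rightMul r A).aemeasurable

theorem isProbabilityMeasure_leastSVRelease {ε : ℝ} (hε : 0 < ε) {n d : ℕ}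
    (A : Matrix (Fin n) (Fin d) ℝ) : IsProbabilityMeasure (leastSVRelease ε A) := by
  have := isProbabilityMeasure_laplace (one_div_pos.2 hε)
  exact Measure.isProbabilityMeasure_map (by fun_prop)

theorem NeighboringMatrices.composition_privacyLE {n d r : ℕ}
    {A A' : Matrix (Fin n) (Fin d) ℝ} (h : NeighboringMatrices A A') {ε δ : ℝ} (hε : 0 < ε)
    (hM : PrivacyLE (gaussianRelease r A) (gaussianRelease r A') ε δ) :
    PrivacyLE (leastSVThenGaussianRelease ε r A) (leastSVThenGaussianRelease ε r A') (2 * ε) δ := by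
  have := isProbabilityMeasure_leastSVRelease hε A
  have := isProbabilityMeasure_leastSVRelease hε A'
  rw [two_mul]
  exact (h.leastSVRelease_privacyLE hε).prod hM

theorem differentiallyPrivateOn_of_privacyLE {I R : Type*} [MeasurableSpace R]
    {nbr : I → I → Prop} (hnbr : ∀ x y, nbr x y → nbr y x) {D : Set I} {alg : I → Measure R}
    {ε δ : ℝ} (h : ∀ x ∈ D, ∀ y, nbr x y →
      PrivacyLE (alg x) (alg y) ε δ ∧ PrivacyLE (alg y) (alg x) ε δ) :
    DifferentiallyPrivateOn nbr D alg ε δ := by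
  rintro x y hxy (hx | hy) S hS
  · exact ⟨(h x hx y hxy).1 S hS, (h x hx y hxy).2 S hS⟩
  · exact ⟨(h y hy x (hnbr x y hxy)).2 S hS, (h y hy x (hnbr x y hxy)).1 S hS⟩

/-! ### Johnson–Lindenstrauss bound for the utility claim. -/

theorem log_one_add_le {x : ℝ} (h0 : 0 ≤ x) (h1 : x ≤ 1 / 2) :
    Real.log (1 + x) ≤ x - x ^ 2 / 4 := by
  rw [Real.log_le_iff_le_exp (by linarith)]
  have hz : 0 ≤ x - x ^ 2 / 4 := by nlinarith
  refine le_trans ?_ (Real.quadratic_le_exp_of_nonneg hz)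
  have h2 : 7 / 8 * x ≤ x - x ^ 2 / 4 := by nlinarith
  nlinarith [pow_le_pow_left₀ (by positivity) h2 2]

theorem log_one_sub_le {x : ℝ} (h0 : 0 ≤ x) (h1 : x < 1) :
    Real.log (1 - x) ≤ -x - x ^ 2 / 2 := by
  have h := (Real.hasSum_pow_div_log_of_abs_lt_one (abs_lt.2 ⟨by linarith, h1⟩)).summable
  have h2 := h.sum_le_tsum (Finset.range 2) fun i _ => by positivity
  rw [(Real.hasSum_pow_div_log_of_abs_lt_one (abs_lt.2 ⟨by linarith, h1⟩)).tsum_eq] at h2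
  norm_num [Finset.sum_range_succ] at h2
  linarith

theorem lintegral_exp_sq_dotProduct {n : ℕ} (y : Fin n → ℝ) {a : ℝ} (ha : a * sqNorm y < 1 / 2) :
    ∫⁻ m, ENNReal.ofReal (Real.exp (a * (∑ i, m i * y i) ^ 2)) ∂(gaussianVector n) =
      ENNReal.ofReal (Real.exp (-Real.log (1 - 2 * (a * sqNorm y)) / 2)) := by
  have hv : 0 ≤ sqNorm y := Finset.sum_nonneg fun _ _ => sq_nonneg _
  -- Scaling a standard Gaussian also covers zero variance.
  have hmap : gaussianReal 0 (∑ i, y i ^ 2).toNNReal =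
      (gaussianReal 0 1).map fun x => √(sqNorm y) * x := by
    rw [gaussianReal_map_const_mul, mul_zero]
    congr 1
    ext
    simp only [mul_one, NNReal.coe_mk, Real.sq_sqrt hv]
    exact Real.coe_toNNReal _ hv
  rw [← lintegral_map (f := fun x : ℝ => ENNReal.ofReal (Real.exp (a * x ^ 2)))
      (g := fun m : Fin n → ℝ => ∑ i, m i * y i) (by fun_prop) (by fun_prop),
    gaussianVector_map_dotProduct, hmap, lintegral_map (by fun_prop) (by fun_prop),
    ← lintegral_exp_mul_sq_gaussianReal ha]
  simp only [mul_pow, Real.sq_sqrt hv, mul_assoc]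

theorem gaussianMatrix_chernoff {r n : ℕ} (y : Fin n → ℝ) {a κ : ℝ} (ha : a * sqNorm y < 1 / 2) :
    gaussianMatrix r n {M | κ ≤ a * sqNorm ((Matrix.of M).mulVec y)} ≤
      ENNReal.ofReal (Real.exp (-κ - r * Real.log (1 - 2 * (a * sqNorm y)) / 2)) := by
  have hmeas : Measurable fun M : Fin r → Fin n → ℝ => sqNorm ((Matrix.of M).mulVec y) := by
    simp only [sqNorm, Matrix.mulVec, dotProduct, Matrix.of_apply]
    fun_prop
  have hS : MeasurableSet {M : Fin r → Fin n → ℝ | κ ≤ a * sqNorm ((Matrix.of M).mulVec y)} :=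
    measurableSet_le measurable_const (hmeas.const_mul a)
  have hprod : ∀ M : Fin r → Fin n → ℝ,
      ENNReal.ofReal (Real.exp (-κ + a * sqNorm ((Matrix.of M).mulVec y))) =
        ENNReal.ofReal (Real.exp (-κ)) *
          ∏ b, ENNReal.ofReal (Real.exp (a * (∑ i, M b i * y i) ^ 2)) := by
    intro M
    rw [Real.exp_add, ENNReal.ofReal_mul (Real.exp_pos _).le,
      ← ENNReal.ofReal_prod_of_nonneg fun b _ => (Real.exp_pos _).le, ← Real.exp_sum,
      ← Finset.mul_sum]
    rfl
  calc _ = ∫⁻ M in {M | κ ≤ a * sqNorm ((Matrix.of M).mulVec y)}, 1 ∂(gaussianMatrix r n) := by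
        simp
    _ ≤ ∫⁻ M in {M | κ ≤ a * sqNorm ((Matrix.of M).mulVec y)},
          ENNReal.ofReal (Real.exp (-κ + a * sqNorm ((Matrix.of M).mulVec y)))
          ∂(gaussianMatrix r n) := by
        refine setLIntegral_mono' hS fun M hM => ?_
        simp only [Set.mem_ofPred_eq] at hM
        exact ENNReal.one_le_ofReal.2 (Real.one_le_exp (by linarith))
    _ ≤ ∫⁻ M, ENNReal.ofReal (Real.exp (-κ + a * sqNorm ((Matrix.of M).mulVec y)))
          ∂(gaussianMatrix r n) := setLIntegral_le_lintegral _ _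
    _ = _ := by
        simp only [hprod]
        rw [lintegral_const_mul _ (by fun_prop), gaussianMatrix,
          lintegral_fin_prod_eq_prod (fun _ : Fin r => gaussianVector n)
            (fun _ m => ENNReal.ofReal (Real.exp (a * (∑ i, m i * y i) ^ 2)))
            (fun _ => by fun_prop),
          lintegral_exp_sq_dotProduct y ha, Finset.prod_const, Finset.card_univ, Fintype.card_fin,
          ← ENNReal.ofReal_pow (Real.exp_pos _).le, ← Real.exp_nat_mul,
          ← ENNReal.ofReal_mul (Real.exp_pos _).le, ← Real.exp_add]
        congr 2
        ring

theorem gaussianMatrix_sqNorm_upper {r n : ℕ} (y : Fin n → ℝ) (hy : 0 < sqNorm y) {η : ℝ}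
    (h0 : 0 < η) (h1 : η < 1 / 2) :
    gaussianMatrix r n {M | r * (1 + η) * sqNorm y ≤ sqNorm ((Matrix.of M).mulVec y)} ≤
      ENNReal.ofReal (Real.exp (-(r * η ^ 2 / 8))) := by
  -- The optimal Chernoff parameter: it makes `1 - 2 a ‖y‖² = (1 + η)⁻¹`, and the exponent becomes
  -- `r (log(1 + η) - η) / 2`.
  set a := η / (2 * (1 + η) * sqNorm y) with ha
  have hav : a * sqNorm y = η / (2 * (1 + η)) := by rw [ha]; field_simp
  have h2 : 1 - 2 * (a * sqNorm y) = (1 + η)⁻¹ := by rw [hav]; field_simp; ring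
  have hlt : a * sqNorm y < 1 / 2 := by
    have := inv_pos.2 (show 0 < 1 + η by linarith)
    linarith
  refine (measure_mono fun M hM => ?_).trans
    ((gaussianMatrix_chernoff (κ := r * η / 2) y hlt).trans (ENNReal.ofReal_le_ofReal ?_))
  · simp only [Set.mem_ofPred_eq] at hM ⊢
    calc r * η / 2 = a * (r * (1 + η) * sqNorm y) := by rw [ha]; field_simp
      _ ≤ _ := by gcongr
  · rw [h2, Real.log_inv]
    refine Real.exp_le_exp.2 ?_
    have := mul_le_mul_of_nonneg_left (log_one_add_le h0.le h1.le) (Nat.cast_nonneg (α := ℝ) r)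
    linarith

theorem gaussianMatrix_sqNorm_lower {r n : ℕ} (y : Fin n → ℝ) (hy : 0 < sqNorm y) {η : ℝ}
    (h0 : 0 < η) (h1 : η < 1 / 2) :
    gaussianMatrix r n {M | sqNorm ((Matrix.of M).mulVec y) ≤ r * (1 - η) * sqNorm y} ≤
      ENNReal.ofReal (Real.exp (-(r * η ^ 2 / 8))) := by
  have hη : 0 < 1 - η := by linarith
  set a := η / (2 * (1 - η) * sqNorm y) with ha
  have hav : a * sqNorm y = η / (2 * (1 - η)) := by rw [ha]; field_simp
  have h2 : 1 - 2 * (-a * sqNorm y) = (1 - η)⁻¹ := by rw [neg_mul, hav]; field_simp; ring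
  have hlt : -a * sqNorm y < 1 / 2 := by
    have := inv_pos.2 hη
    linarith
  refine (measure_mono fun M hM => ?_).trans
    ((gaussianMatrix_chernoff (κ := -(r * η / 2)) y hlt).trans (ENNReal.ofReal_le_ofReal ?_))
  · simp only [Set.mem_ofPred_eq] at hM ⊢
    have h3 : r * η / 2 = a * (r * (1 - η) * sqNorm y) := by rw [ha]; field_simp
    rw [h3, neg_mul, neg_le_neg_iff]
    gcongr
  · rw [h2, Real.log_inv]
    refine Real.exp_le_exp.2 ?_
    have := mul_le_mul_of_nonneg_left (log_one_sub_le h0.le (by linarith))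
      (Nat.cast_nonneg (α := ℝ) r)
    nlinarith [mul_nonneg (Nat.cast_nonneg (α := ℝ) r) (sq_nonneg η)]

theorem two_mul_exp_numRows_le {η ν : ℝ} (hη : 0 < η) (hν : 0 < ν) :
    2 * Real.exp (-(numRows η ν * η ^ 2 / 8)) ≤ ν := by
  have h := Nat.le_ceil (8 * Real.log (2 / ν) / η ^ 2)
  rw [div_le_iff₀ (by positivity)] at h
  change 8 * Real.log (2 / ν) ≤ numRows η ν * η ^ 2 at h
  have h2 : Real.exp (-(numRows η ν * η ^ 2 / 8)) ≤ Real.exp (-Real.log (2 / ν)) :=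
    Real.exp_le_exp.2 (by linarith)
  rw [Real.exp_neg (Real.log _), Real.exp_log (by positivity), inv_div] at h2
  linarith

theorem numRows_pos {η ν : ℝ} (hη : 0 < η) (hν : 0 < ν) (hν2 : ν < 2) : 0 < numRows η ν := by
  refine Nat.ceil_pos.2 (div_pos (mul_pos (by norm_num) (Real.log_pos ?_)) (by positivity))
  rwa [one_lt_div hν]

/-- The Johnson–Lindenstrauss estimate for the released matrix. -/
theorem gaussianRelease_utility {n d : ℕ} {η ν : ℝ} (hη : 0 < η) (hν : 0 < ν) (h1 : η < 1 / 2)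
    (A : Matrix (Fin n) (Fin d) ℝ) (x : Fin d → ℝ) :
    ENNReal.ofReal (1 - ν) ≤ gaussianRelease (numRows η ν) A
      {O | (1 - η) * sqNorm (A.mulVec x) ≤
          1 / (numRows η ν : ℝ) * sqNorm ((Matrix.of O).mulVec x) ∧
        1 / (numRows η ν : ℝ) * sqNorm ((Matrix.of O).mulVec x) ≤
          (1 + η) * sqNorm (A.mulVec x)} := by
  rcases le_or_gt 2 ν with hν2 | hν2
  -- For `ν ≥ 2`, where `r = 0`, the probability bound is vacuous.
  · rw [ENNReal.ofReal_of_nonpos (by linarith)]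
    exact zero_le
  have hr := numRows_pos hη hν hν2
  have hbound := two_mul_exp_numRows_le hη hν
  set r := numRows η ν
  have hr' : (0 : ℝ) < r := by exact_mod_cast hr
  set y := A.mulVec x with hy
  set G := {O : Fin r → Fin d → ℝ | (1 - η) * sqNorm y ≤
      1 / (r : ℝ) * sqNorm ((Matrix.of O).mulVec x) ∧
    1 / (r : ℝ) * sqNorm ((Matrix.of O).mulVec x) ≤ (1 + η) * sqNorm y} with hG
  have hmeas : Measurable fun O : Fin r → Fin d → ℝ => sqNorm ((Matrix.of O).mulVec x) := by
    simp only [sqNorm, Matrix.mulVec, dotProduct, Matrix.of_apply]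
    fun_prop
  have hGm : MeasurableSet G :=
    (measurableSet_le measurable_const (hmeas.const_mul _)).inter
      (measurableSet_le (hmeas.const_mul _) measurable_const)
  have hbad : gaussianRelease r A Gᶜ ≤ ENNReal.ofReal ν := by
    rw [gaussianRelease_eq_map, Measure.map_apply (measurable_rightMul r A) hGm.compl]
    have hO : ∀ M : Fin r → Fin n → ℝ,
        (Matrix.of (rightMul r A M)).mulVec x = (Matrix.of M).mulVec y :=
      fun M => (Matrix.mulVec_mulVec x (Matrix.of M) A).symm
    rcases (show 0 ≤ sqNorm y from Finset.sum_nonneg fun _ _ => sq_nonneg _).eq_or_lt with h0 | h0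
    -- The Chernoff parameters divide by `‖y‖²`; for `y = 0` both inequalities read `0 ≤ 0`.
    · have hy0 : y = 0 := by
        ext i
        have := (Finset.sum_eq_zero_iff_of_nonneg fun i _ => sq_nonneg (y i)).1 h0.symm i
          (Finset.mem_univ i)
        simpa using this
      have hempty : rightMul r A ⁻¹' Gᶜ = ∅ := by
        refine Set.eq_empty_of_forall_notMem fun M hM => hM ?_
        simp only [hG, Set.mem_ofPred_eq, hO]
        simp [hy0, sqNorm]
      rw [hempty]
      simp
    · calc _ ≤ gaussianMatrix r n
            ({M | r * (1 + η) * sqNorm y ≤ sqNorm ((Matrix.of M).mulVec y)} ∪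
              {M | sqNorm ((Matrix.of M).mulVec y) ≤ r * (1 - η) * sqNorm y}) := by
            refine measure_mono fun M hM => ?_
            by_contra hcon
            simp only [Set.mem_union, Set.mem_ofPred_eq, not_or, not_le] at hcon
            refine hM ?_
            simp only [hG, Set.mem_ofPred_eq, hO, one_div, le_inv_mul_iff₀ hr', inv_mul_le_iff₀ hr']
            constructor <;> linarith [hcon.1, hcon.2]
        _ ≤ ENNReal.ofReal (Real.exp (-(r * η ^ 2 / 8))) +
              ENNReal.ofReal (Real.exp (-(r * η ^ 2 / 8))) :=
            (measure_union_le _ _).trans (add_le_add (gaussianMatrix_sqNorm_upper y h0 hη h1)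
              (gaussianMatrix_sqNorm_lower y h0 hη h1))
        _ ≤ ENNReal.ofReal ν := by
            rw [← ENNReal.ofReal_add (Real.exp_pos _).le (Real.exp_pos _).le]
            exact ENNReal.ofReal_le_ofReal (by linarith)
  rw [ENNReal.ofReal_sub _ hν.le, ENNReal.ofReal_one, tsub_le_iff_right,
    ← measure_univ (μ := gaussianRelease r A), ← measure_add_measure_compl hGm]
  gcongr

/-! ### The main theorem. -/

theorem mainTheorem5 (n d : ℕ) (ε δ η ν : ℝ) (hε : 0 < ε) (hδ : 0 < δ) (hη : 0 < η) (hν : 0 < ν)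
    (hεδ : ε ≤ 2 * Real.log (2 / δ)) (r : ℕ) (hr : r = numRows η ν) (w : ℝ)
    (hw : w = threshold ε δ r) :
    -- publishing `M A` is private on the matrices all of whose singular values are at least `w`
    DifferentiallyPrivateOn NeighboringMatrices
      {A : Matrix (Fin n) (Fin d) ℝ | ∀ i : Fin d, w ≤ sv A i} (gaussianRelease r) ε δ ∧
    -- publishing `σ_d + Lap(1 / ε)` is private
    DifferentiallyPrivateOn NeighboringMatrices
      (Set.univ : Set (Matrix (Fin n) (Fin d) ℝ)) (leastSVRelease ε) ε 0 ∧
    -- publishing `σ_d + Lap(1 / ε)` and then `M A` is private on the matrices with `σ_d > 10 w`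
    DifferentiallyPrivateOn NeighboringMatrices
      {A : Matrix (Fin n) (Fin d) ℝ | 10 * w < leastSV A}
      (leastSVThenGaussianRelease ε r) (2 * ε) δ ∧
    -- the published matrix `O = M A` answers directional variance queries
    (η < 1 / 2 → ∀ (A : Matrix (Fin n) (Fin d) ℝ) (x : Fin d → ℝ), sqNorm x = 1 →
      ENNReal.ofReal (1 - ν) ≤ gaussianRelease r A
        {O | (1 - η) * sqNorm (A.mulVec x) ≤ 1 / (r : ℝ) * sqNorm ((Matrix.of O).mulVec x) ∧
          1 / (r : ℝ) * sqNorm ((Matrix.of O).mulVec x) ≤ (1 + η) * sqNorm (A.mulVec x)}) := by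
  subst hw
  refine ⟨?_, ?_, ?_, ?_⟩
  · exact differentiallyPrivateOn_of_privacyLE (fun _ _ h => h.symm) fun A hA A' h =>
      h.gaussianRelease_privacyLE hε hδ hεδ hA
  · exact differentiallyPrivateOn_of_privacyLE (fun _ _ h => h.symm) fun A _ A' h =>
      ⟨h.leastSVRelease_privacyLE hε, h.symm.leastSVRelease_privacyLE hε⟩
  · refine differentiallyPrivateOn_of_privacyLE (fun _ _ h => h.symm) fun A hA A' h => ?_
    -- Nonnegativity of `w` turns `σ_d > 10 w` into the bound `w ≤ σᵢ` for every `i`.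
    have hw := threshold_nonneg hε hδ hεδ r
    have hM := h.gaussianRelease_privacyLE (r := r) hε hδ hεδ fun i => by
      have h1 : 10 * threshold ε δ r < leastSV A := hA
      linarith [leastSV_le_sv A i]
    exact ⟨h.composition_privacyLE hε hM.1, h.symm.composition_privacyLE hε hM.2⟩
  · subst hr
    exact fun h1 A x _ => gaussianRelease_utility hη hν h1 A x
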